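/- Let $\alpha^+,\lambda^+,\alpha^-,\lambda^->0$. Let $f$ be the density of the bilateral Gamma distribution, i.e. of the law of $X-Y$ with $X\sim\Gamma(\alpha^+,\lambda^+)$ and $Y\sim\Gamma(\alpha^-,\lambda^-)$ independent (shape, rate); explicitly, $$f(x)=\int_{\mathbb R} g_{\alpha^+,\lambda^+}(x+y)\,g_{\alpha^-,\lambda^-}(y)\,dy,\qquad g_{a,r}(t)=\frac{r^a}{\Gamma(a)}t^{a-1}e^{-rt}\mathbf 1_{\{t>0\}}.$$ Let $N=\lceil\alpha^++\alpha^-\rceil-1$ and $\mathbb N=\{1,2,\dots\}$. Then $f\in C^N(\mathbb R\setminus\{0\})$, and: 1. The limit $\lim_{x\downarrow0}f^{(N)}(x)$ exists and is finite if and only if $\alpha^+\in\mathbb N$. 2. If $\alpha^+\notin\mathbb N$ and $\alpha^++\alpha^-\notin\mathbb N$, then $f^{(N)}(x)\sim C_1x^{-\alpha}$ as $x\downarrow0$, where $\alpha=N+1-\alpha^+-\alpha^-\in(0,1)$ and $$C_1=\frac{(\lambda^+)^{\alpha^+}(\lambda^-)^{\alpha^-}\sin(\alpha^+\pi)}{\Gamma(\alpha^++\alpha^--N)\,\sin((\alpha^++\alpha^-)\pi)}\neq0.$$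 3. If $\alpha^+\notin\mathbb N$ and $\alpha^++\alpha^-\in\mathbb N$, then $f^{(N)}(x)\sim(-1)^{\lfloor\alpha^-\rfloor}M(x)$ as $x\to0$ (from both sides), where $M:\mathbb R\to\mathbb R$ is slowly varying as $x\to0$ (measurable, positive for all sufficiently small $x\neq0$, and $M(cx)/M(x)\to1$ as $x\to0$ for every $c>0$) and $\lim_{x\to0}M(x)=\infty$. Moreover $$\lim_{x\downarrow0}\bigl(f^{(N)}(x)-f^{(N)}(-x)\bigr)=C_2=\frac{(\lambda^+)^{\alpha^+}(\lambda^-)^{\alpha^-}}2\Bigl((-1)^{N+1}\cos(\alpha^+\pi)+\cos(\alpha^-\pi)\Bigr).$$ -/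

import Mathlib

open MeasureTheory ProbabilityTheory Filter Topology Asymptotics

/-- The bilateral Gamma distribution: the law of `X - Y`, where `X` and `Y` are independent,
`X ∼ Γ(αp, lp)` and `Y ∼ Γ(αm, lm)` (shape, rate). -/
noncomputable def bilateralGammaMeasure (αp lp αm lm : ℝ) : Measure ℝ :=
  ((gammaMeasure αp lp).prod (gammaMeasure αm lm)).map (fun p : ℝ × ℝ => p.1 - p.2)

/-- The density of the bilateral Gamma distribution, as the convolution of the density of `X`
with that of `-Y`. -/
noncomputable def bilateralGammaPDF (αp lp αm lm : ℝ) (x : ℝ) : ℝ :=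
  ∫ y, gammaPDFReal αp lp (x + y) * gammaPDFReal αm lm y

/-- The order `N = ⌈αp + αm⌉ - 1` of the first discontinuous derivative of the density. -/
noncomputable def bilateralGammaOrder (αp αm : ℝ) : ℕ := ⌈αp + αm⌉₊ - 1

/-- The constant in the power-law asymptotics at zero. -/
noncomputable def bilateralGammaC₁ (αp lp αm lm : ℝ) : ℝ :=
  (lp ^ αp * lm ^ αm * Real.sin (αp * Real.pi)) /
    (Real.Gamma (αp + αm - bilateralGammaOrder αp αm) * Real.sin ((αp + αm) * Real.pi))

/-- The limiting difference between the two sides of zero. -/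
noncomputable def bilateralGammaC₂ (αp lp αm lm : ℝ) : ℝ :=
  (lp ^ αp * lm ^ αm) / 2 *
    ((-1) ^ (bilateralGammaOrder αp αm + 1) * Real.cos (αp * Real.pi)
      + Real.cos (αm * Real.pi))

/-- `M` is slowly varying as `x → 0` (from both sides). -/
def IsSlowlyVaryingAtZero (M : ℝ → ℝ) : Prop :=
  Measurable M ∧ (∀ᶠ x in 𝓝[≠] 0, 0 < M x) ∧
    ∀ c : ℝ, 0 < c → Tendsto (fun x => M (c * x) / M x) (𝓝[≠] 0) (𝓝 1)

/-- `bilateralGammaPDF` is indeed a Lebesgue density of the bilateral Gamma distribution. -/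
theorem bilateralGammaMeasure_eq_withDensity {αp lp αm lm : ℝ}
    (hαp : 0 < αp) (hlp : 0 < lp) (hαm : 0 < αm) (hlm : 0 < lm) :
    bilateralGammaMeasure αp lp αm lm =
      volume.withDensity (fun x => ENNReal.ofReal (bilateralGammaPDF αp lp αm lm x)) := by
  have mg : ∀ a r : ℝ, Measurable (gammaPDF a r) := fun a r =>
    (measurable_gammaPDFReal a r).ennreal_ofReal
  have := isProbabilityMeasure_gammaMeasure hαp hlp
  have := isProbabilityMeasure_gammaMeasure hαm hlm
  have hmeas : Measurable (fun p : ℝ × ℝ => gammaPDF αp lp (p.1 + p.2) * gammaPDF αm lm p.2) :=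
    ((mg αp lp).comp (measurable_fst.add measurable_snd)).mul ((mg αm lm).comp measurable_snd)
  have key : ∀ s : Set ℝ, MeasurableSet s → bilateralGammaMeasure αp lp αm lm s =
      ∫⁻ x in s, ∫⁻ y, gammaPDF αp lp (x + y) * gammaPDF αm lm y := by
    intro s hs
    have hsub : Measurable (fun p : ℝ × ℝ => p.1 - p.2) := measurable_fst.sub measurable_snd
    have hind : Measurable (s.indicator (1 : ℝ → ENNReal)) := measurable_one.indicator hs
    rw [bilateralGammaMeasure, ← lintegral_indicator_one hs, lintegral_map hind hsub,
      lintegral_prod_symm (fun p : ℝ × ℝ => s.indicator (1 : ℝ → ENNReal) (p.1 - p.2))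
        (hind.comp hsub).aemeasurable]
    have h1 : ∀ y : ℝ, ∫⁻ x, s.indicator (1 : ℝ → ENNReal) (x - y) ∂(gammaMeasure αp lp) =
        ∫⁻ x in s, gammaPDF αp lp (x + y) := by
      intro y
      have h0 : Measurable (fun x : ℝ => s.indicator (1 : ℝ → ENNReal) (x - y)) :=
        hind.comp (measurable_id.sub_const y)
      rw [gammaMeasure, lintegral_withDensity_eq_lintegral_mul _ (mg αp lp) h0, ← lintegral_add_right_eq_self _ y,
        ← lintegral_indicator hs]
      refine lintegral_congr fun x => ?_
      by_cases hx : x ∈ s <;> simp [hx]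
    simp only [h1]
    have h2 : Measurable (fun y : ℝ => ∫⁻ x in s, gammaPDF αp lp (x + y)) :=
      Measurable.lintegral_prod_left' (f := fun p : ℝ × ℝ => gammaPDF αp lp (p.1 + p.2))
        ((mg αp lp).comp (measurable_fst.add measurable_snd))
    rw [gammaMeasure, lintegral_withDensity_eq_lintegral_mul _ (mg αm lm) h2,
      lintegral_lintegral_swap hmeas.aemeasurable]
    refine lintegral_congr fun y => ?_
    have h3 : Measurable (fun x : ℝ => gammaPDF αp lp (x + y)) :=
      (mg αp lp).comp (measurable_add_const y)
    rw [Pi.mul_apply, mul_comm, lintegral_mul_const _ h3]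
  have hG : Measurable (fun x : ℝ => ∫⁻ y, gammaPDF αp lp (x + y) * gammaPDF αm lm y) :=
    hmeas.lintegral_prod_right'
  have hfin : ∀ᵐ x : ℝ, ∫⁻ y, gammaPDF αp lp (x + y) * gammaPDF αm lm y < ⊤ := by
    refine ae_lt_top hG ?_
    rw [← setLIntegral_univ, ← key _ MeasurableSet.univ, bilateralGammaMeasure,
      Measure.map_apply (f := fun p : ℝ × ℝ => p.1 - p.2)
        (measurable_fst.sub measurable_snd) MeasurableSet.univ]
    exact measure_ne_top _ _
  have hae : ∀ᵐ x : ℝ, ∫⁻ y, gammaPDF αp lp (x + y) * gammaPDF αm lm y =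
      ENNReal.ofReal (bilateralGammaPDF αp lp αm lm x) := by
    filter_upwards [hfin] with x hx
    have hnn : ∀ y, 0 ≤ gammaPDFReal αp lp (x + y) * gammaPDFReal αm lm y := fun y =>
      mul_nonneg (gammaPDFReal_nonneg hαp hlp _) (gammaPDFReal_nonneg hαm hlm _)
    have hm : Measurable (fun y => gammaPDFReal αp lp (x + y) * gammaPDFReal αm lm y) :=
      ((measurable_gammaPDFReal αp lp).comp (measurable_const_add x)).mul
        (measurable_gammaPDFReal αm lm)
    have heq : ∀ y, gammaPDF αp lp (x + y) * gammaPDF αm lm y =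
        ENNReal.ofReal (gammaPDFReal αp lp (x + y) * gammaPDFReal αm lm y) := fun y =>
      (ENNReal.ofReal_mul (gammaPDFReal_nonneg hαp hlp _)).symm
    simp only [heq] at hx ⊢
    rw [bilateralGammaPDF, integral_eq_lintegral_of_nonneg_ae (ae_of_all _ hnn)
      hm.aestronglyMeasurable, ENNReal.ofReal_toReal hx.ne]
  ext s hs
  rw [key s hs, withDensity_apply _ hs]
  exact lintegral_congr_ae (ae_restrict_of_ae hae)

/-!
On `(0, ∞)` the density `f_c` with shapes `c, b` and rates `lp, lm` is, up to the factor
`exp (-(lp * x))` and a constant, the integral of `(x + y)^(c-1) y^(b-1) exp (-((lp + lm) * y))`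
over `y > 0`, which makes sense for every real `c`. Since `f_c' = lp * (f_(c-1) - f_c)`, the `n`-th
derivative of `f_c` differs from `lp^n * f_(c-n)` by a function with a finite limit at zero as long
as `n < c + b`, so only the leading behaviour of `f_(c-n)` matters. Substituting `y = x * t`, it is
a power of `x` times a Beta integral when `c - n + b < 1` and a multiple of `log x` when
`c - n + b = 1`, and `f_(c-n)` vanishes identically when `c - n` is a nonpositive integer.

The difference of `f⁽ⁿ⁾` across zero obeys the same recursion on both sides, as long as the shape
that is lowered exceeds one. This reduces the jump to the case `a + b = 1`, where its limit is
`lp^a * lm^b * sin (π b) / π` times the integral of `t^(b-1) (1+t)^(-b) - t^(a-1) (1+t)^(-a)` over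
`t > 0`. The integral equals `ψ(a) - ψ(b)`, with `ψ` the logarithmic derivative of `Γ`, which is
`π cot (π b)` by the reflection formula.
-/

theorem isEquivalent_const_mul_of_tendsto_div {α : Type*} {l : Filter α} {f g : α → ℝ} {C : ℝ}
    (hC : C ≠ 0) (h : Tendsto (fun x => f x / g x) l (𝓝 C)) : f ~[l] fun x => C * g x := by
  refine isEquivalent_of_tendsto_one (?_ : Tendsto (fun x => f x / (C * g x)) l (𝓝 1))
  simpa only [div_div, mul_comm C, div_self hC] using h.div_const C

theorem not_tendsto_nhds_of_tendsto_div {α : Type*} {l : Filter α} [l.NeBot] {f g : α → ℝ}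
    {C : ℝ} (hC : C ≠ 0) (hg : Tendsto g l atTop) (h : Tendsto (fun x => f x / g x) l (𝓝 C))
    (L : ℝ) : ¬ Tendsto f l (𝓝 L) :=
  fun hL => hC (tendsto_nhds_unique h (hL.div_atTop hg))

theorem tendsto_inv_smul_of_tendsto_deriv {E : Type*} [NormedAddCommGroup E] [NormedSpace ℝ E]
    {f f' : ℝ → E} {l : E} (hf : ∀ᶠ x in atTop, HasDerivAt f (f' x) x)
    (hl : Tendsto f' atTop (𝓝 l)) : Tendsto (fun x => x⁻¹ • f x) atTop (𝓝 l) := by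
  have hlittle : (fun x => f x - x • l) =o[atTop] (fun x : ℝ => x) := by
    refine isLittleO_iff.2 fun ε hε => ?_
    have hclose : ∀ᶠ x in atTop, ‖f' x - l‖ ≤ ε / 2 :=
      (tendsto_iff_norm_sub_tendsto_zero.1 hl).eventually_le_const (half_pos hε)
    obtain ⟨u, hu⟩ := eventually_atTop.1 (hf.and hclose)
    filter_upwards [eventually_ge_atTop u, eventually_ge_atTop 0,
      (tendsto_id.const_mul_atTop (half_pos hε)).eventually_ge_atTop
        (‖f u - u • l‖ - ε / 2 * u)] with x hux hx hfu
    have hmean : ‖(f x - x • l) - (f u - u • l)‖ ≤ ε / 2 * ‖x - u‖ :=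
      (convex_Ici u).norm_image_sub_le_of_norm_hasDerivWithin_le (f := fun x => f x - x • l)
        (f' := fun x => f' x - l)
        (fun y hy => by
          simpa using ((hu y hy).1.fun_sub ((hasDerivAt_id y).smul_const l)).hasDerivWithinAt)
        (fun y hy => (hu y hy).2) Set.self_mem_Ici hux
    have htri := norm_sub_norm_le (f x - x • l) (f u - u • l)
    rw [Real.norm_of_nonneg (sub_nonneg.2 hux)] at hmean
    rw [Real.norm_of_nonneg hx]
    simp only [id] at hfu
    linarith
  refine (zero_add l ▸ hlittle.tendsto_inv_smul_nhds_zero.add_const l).congr' ?_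
  filter_upwards [eventually_ne_atTop 0] with x hx
  rw [smul_sub, inv_smul_smul₀ hx, sub_add_cancel]

theorem tendsto_div_log_of_tendsto_mul_deriv {h h' : ℝ → ℝ} {l : ℝ}
    (hd : ∀ᶠ x in 𝓝[>] 0, HasDerivAt h (h' x) x)
    (hl : Tendsto (fun x => x * h' x) (𝓝[>] 0) (𝓝 l)) :
    Tendsto (fun x => h x / Real.log x) (𝓝[>] 0) (𝓝 l) := by
  have hexp : Tendsto (fun u => Real.exp (-u)) atTop (𝓝[>] 0) :=
    Real.tendsto_exp_atBot_nhdsGT.comp tendsto_neg_atTop_atBot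
  have hderiv : ∀ᶠ u in atTop, HasDerivAt (fun u => h (Real.exp (-u)))
      (-(Real.exp (-u) * h' (Real.exp (-u)))) u := by
    filter_upwards [hexp.eventually hd] with u hu
    exact (hu.comp u (hasDerivAt_neg u).exp).congr_deriv (by ring)
  have hcesaro := (tendsto_inv_smul_of_tendsto_deriv hderiv (hl.comp hexp).neg).comp
    (tendsto_neg_atBot_atTop.comp Real.tendsto_log_nhdsGT_zero)
  refine (neg_neg l ▸ hcesaro.neg).congr' ?_
  filter_upwards [self_mem_nhdsWithin] with x hx
  simp [Real.exp_log hx, div_eq_inv_mul]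

theorem tendsto_integral_mul_exp_neg_mul {h : ℝ → ℝ} (hh : IntegrableOn h (Set.Ioi 0)) :
    Tendsto (fun z => ∫ t in Set.Ioi 0, h t * Real.exp (-(z * t))) (𝓝[>] 0)
      (𝓝 (∫ t in Set.Ioi 0, h t)) := by
  refine tendsto_integral_filter_of_dominated_convergence (fun t => ‖h t‖)
    (Eventually.of_forall fun z => hh.aestronglyMeasurable.mul
      (by fun_prop : Measurable _).aestronglyMeasurable) ?_ hh.norm (ae_of_all _ fun t => ?_)
  · filter_upwards [self_mem_nhdsWithin] with z (hz : 0 < z)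
    refine ae_restrict_of_forall_mem measurableSet_Ioi fun t (ht : 0 < t) => ?_
    rw [norm_mul, Real.norm_of_nonneg (Real.exp_pos _).le]
    exact mul_le_of_le_one_right (norm_nonneg _)
      (Real.exp_le_one_iff.2 (neg_nonpos.2 (by positivity)))
  · have hcont : Continuous fun z => h t * Real.exp (-(z * t)) := by fun_prop
    simpa using (hcont.tendsto 0).mono_left nhdsWithin_le_nhds

theorem rpow_le_rpow_add_rpow_of_mem_Icc {u v w : ℝ} (hu : 0 < u) (hv : v ∈ Set.Icc u w) (p : ℝ) :
    v ^ p ≤ u ^ p + w ^ p := by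
  have hv0 : 0 < v := hu.trans_le hv.1
  rcases le_total 0 p with hp | hp
  · exact (Real.rpow_le_rpow hv0.le hv.2 hp).trans
      (le_add_of_nonneg_left (Real.rpow_nonneg hu.le p))
  · exact (Real.rpow_le_rpow_of_nonpos hu hv.1 hp).trans
      (le_add_of_nonneg_right (Real.rpow_nonneg (hv0.le.trans hv.2) p))

theorem rpow_eq_mul_rpow_sub_one {r : ℝ} (hr : 0 < r) (c : ℝ) : r ^ c = r * r ^ (c - 1) := by
  rw [Real.rpow_sub_one hr.ne', mul_div_cancel₀ _ hr.ne']

section BetaIntegral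

variable {p q a b t : ℝ}

theorem integral_Ioo_rpow_mul_one_sub_rpow (hp : 0 < p) (hq : 0 < q) :
    ∫ v in Set.Ioo (0 : ℝ) 1, v ^ (p - 1) * (1 - v) ^ (q - 1) = beta p q := by
  have hmass := lintegral_betaPDF_eq_one hp hq
  rw [lintegral_betaPDF] at hmass
  have hone : ∫ v in Set.Ioo (0 : ℝ) 1, 1 / beta p q * v ^ (p - 1) * (1 - v) ^ (q - 1) = 1 := by
    rw [integral_eq_lintegral_of_nonneg_ae, hmass, ENNReal.toReal_one]
    · refine ae_restrict_of_forall_mem measurableSet_Ioo fun v hv => ?_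
      have hβ := beta_pos hp hq
      exact mul_nonneg (mul_nonneg (by positivity) (Real.rpow_nonneg hv.1.le _))
        (Real.rpow_nonneg (sub_pos.2 hv.2).le _)
    · exact Measurable.aestronglyMeasurable (by fun_prop)
  simp_rw [mul_assoc] at hone
  rw [integral_const_mul, one_div, inv_mul_eq_one₀ (beta_pos hp hq).ne'] at hone
  exact hone.symm

theorem image_div_one_sub_Ioo : (fun v : ℝ => v / (1 - v)) '' Set.Ioo 0 1 = Set.Ioi 0 := by
  ext y
  refine ⟨?_, fun (hy : 0 < y) => ⟨y / (1 + y), ⟨by positivity, ?_⟩, ?_⟩⟩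
  · rintro ⟨v, hv, rfl⟩
    exact div_pos hv.1 (sub_pos.2 hv.2)
  · exact (div_lt_one (by positivity)).2 (lt_one_add y)
  · field_simp
    ring

theorem injOn_div_one_sub_Ioo : Set.InjOn (fun v : ℝ => v / (1 - v)) (Set.Ioo 0 1) := by
  intro v hv w hw h
  have hcross := (div_eq_div_iff (sub_pos.2 hv.2).ne' (sub_pos.2 hw.2).ne').1 h
  linarith

theorem hasDerivAt_div_one_sub {v : ℝ} (hv : v ≠ 1) :
    HasDerivAt (fun v : ℝ => v / (1 - v)) (1 / (1 - v) ^ 2) v := by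
  have hv' : 1 - v ≠ 0 := sub_ne_zero.2 hv.symm
  exact ((hasDerivAt_id' v).fun_div ((hasDerivAt_id' v).const_sub 1) hv').congr_deriv (by ring)

theorem integral_rpow_mul_one_add_rpow (hp : 0 < p) (hq : 0 < q) :
    ∫ t in Set.Ioi (0 : ℝ), t ^ (p - 1) * (1 + t) ^ (-(p + q)) = beta p q := by
  rw [← integral_Ioo_rpow_mul_one_sub_rpow hp hq, ← image_div_one_sub_Ioo,
    integral_image_eq_integral_abs_deriv_smul measurableSet_Ioo
      (fun v hv => (hasDerivAt_div_one_sub hv.2.ne).hasDerivWithinAt) injOn_div_one_sub_Ioo]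
  refine setIntegral_congr_fun measurableSet_Ioo fun v hv => ?_
  have hv0 : 0 < v := hv.1
  have hv1 : 0 < 1 - v := sub_pos.2 hv.2
  have hinv : 1 + v / (1 - v) = (1 - v)⁻¹ := by
    field_simp
    ring
  have hpow : (1 - v) ^ (q - 1) =
      (1 - v) ^ (p + q) / ((1 - v) ^ (2 : ℝ) * (1 - v) ^ (p - 1)) := by
    rw [← Real.rpow_add hv1, ← Real.rpow_sub hv1]
    ring_nf
  simp only [smul_eq_mul]
  rw [abs_of_pos (by positivity), hinv, Real.inv_rpow hv1.le, Real.rpow_neg hv1.le, inv_inv,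
    Real.div_rpow hv0.le hv1.le, hpow, Real.rpow_two]
  field_simp

theorem integrableOn_rpow_mul_one_add_rpow (hp : 0 < p) (hq : 0 < q) :
    IntegrableOn (fun t : ℝ => t ^ (p - 1) * (1 + t) ^ (-(p + q))) (Set.Ioi 0) :=
  not_imp_comm.1 integral_undef
    (integral_rpow_mul_one_add_rpow hp hq ▸ (beta_pos hp hq).ne')

theorem rpow_mul_one_add_rpow_neg_sub_le (hab : a ≤ b + 1) (ht : 0 < t) :
    t ^ (b - 1) * (1 + t) ^ (-b) - t ^ (a - 1) * (1 + t) ^ (-a) ≤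
      t ^ (b - 1) * (1 + t) ^ (-(b + 1)) := by
  have ht1 : 0 < 1 + t := by positivity
  have hratio (p : ℝ) : t ^ (p - 1) * (1 + t) ^ (-p) = (t / (1 + t)) ^ p / t := by
    rw [Real.div_rpow ht.le ht1.le, Real.rpow_neg ht1.le, Real.rpow_sub_one ht.ne']
    ring
  have hmono : (t / (1 + t)) ^ (b + 1) ≤ (t / (1 + t)) ^ a :=
    Real.rpow_le_rpow_of_exponent_ge (by positivity)
      ((div_le_one ht1).2 (by linarith)) hab
  have hsub : t ^ (b - 1) * (1 + t) ^ (-(b + 1)) =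
      (t / (1 + t)) ^ b / t - (t / (1 + t)) ^ (b + 1) / t := by
    rw [neg_add, ← sub_eq_add_neg, Real.rpow_sub_one ht1.ne', ← mul_div_assoc, hratio,
      Real.rpow_add_one (by positivity)]
    field_simp
    ring
  rw [hsub, hratio, hratio]
  gcongr

theorem integrableOn_rpow_mul_one_add_rpow_neg_sub (ha : 0 < a) (hb : 0 < b) (hab : |a - b| ≤ 1) :
    IntegrableOn (fun t : ℝ => t ^ (b - 1) * (1 + t) ^ (-b) - t ^ (a - 1) * (1 + t) ^ (-a))
      (Set.Ioi 0) := by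
  obtain ⟨hba, hab⟩ := abs_le.1 hab
  refine ((integrableOn_rpow_mul_one_add_rpow hb one_pos).add
    (integrableOn_rpow_mul_one_add_rpow ha one_pos)).mono'
    (Measurable.aestronglyMeasurable (by fun_prop))
    (ae_restrict_of_forall_mem measurableSet_Ioi fun t (ht : 0 < t) => ?_)
  have hupper := rpow_mul_one_add_rpow_neg_sub_le (by linarith : a ≤ b + 1) ht
  have hlower := rpow_mul_one_add_rpow_neg_sub_le (by linarith : b ≤ a + 1) ht
  have hposb : 0 ≤ t ^ (b - 1) * (1 + t) ^ (-(b + 1)) := by positivity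
  have hposa : 0 ≤ t ^ (a - 1) * (1 + t) ^ (-(a + 1)) := by positivity
  rw [Pi.add_apply, Real.norm_eq_abs, abs_le]
  constructor <;> linarith

theorem tendsto_beta_sub_beta (ha : 0 < a) (hb : 0 < b) :
    Tendsto (fun ε => beta b ε - beta a ε) (𝓝[>] 0)
      (𝓝 (logDeriv Real.Gamma a - logDeriv Real.Gamma b)) := by
  have hratio (c : ℝ) (hc : 0 < c) :
      HasDerivAt (fun ε => Real.Gamma c / Real.Gamma (c + ε)) (-logDeriv Real.Gamma c) 0 := by
    have hΓ : Real.Gamma (c + 0) ≠ 0 := by simpa using (Real.Gamma_pos_of_pos hc).ne'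
    have hd : HasDerivAt Real.Gamma (deriv Real.Gamma c) (c + 0) := by
      rw [add_zero]
      exact (Real.differentiableOn_Gamma_Ioi.differentiableAt (Ioi_mem_nhds hc)).hasDerivAt
    refine ((hasDerivAt_const 0 (Real.Gamma c)).fun_div (hd.comp_const_add c 0) hΓ).congr_deriv ?_
    rw [add_zero] at hΓ ⊢
    rw [logDeriv_apply]
    field_simp
    ring
  have hΓ₁ : Tendsto (fun ε => Real.Gamma (ε + 1)) (𝓝[>] 0) (𝓝 1) := by
    have hcont : ContinuousAt (fun ε : ℝ => Real.Gamma (ε + 1)) 0 :=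
      ContinuousAt.comp (f := fun ε : ℝ => ε + 1)
        (Real.differentiableOn_Gamma_Ioi.differentiableAt
          (Ioi_mem_nhds (by norm_num))).continuousAt (by fun_prop)
    simpa using hcont.tendsto.mono_left nhdsWithin_le_nhds
  have hslope := ((hratio b hb).fun_sub (hratio a ha)).tendsto_slope_zero_right
  rw [show logDeriv Real.Gamma a - logDeriv Real.Gamma b =
    (-logDeriv Real.Gamma b - -logDeriv Real.Gamma a) * 1 by ring]
  refine (hslope.mul hΓ₁).congr' ?_
  filter_upwards [self_mem_nhdsWithin] with ε (hε : 0 < ε)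
  rw [Real.Gamma_add_one hε.ne', add_zero, add_zero, zero_add,
    div_self (Real.Gamma_pos_of_pos hb).ne', div_self (Real.Gamma_pos_of_pos ha).ne', sub_self,
    sub_zero, smul_eq_mul, beta, beta]
  field_simp

theorem integral_rpow_mul_one_add_rpow_neg_sub (ha : 0 < a) (hb : 0 < b) (hab : |a - b| ≤ 1) :
    ∫ t in Set.Ioi (0 : ℝ), (t ^ (b - 1) * (1 + t) ^ (-b) - t ^ (a - 1) * (1 + t) ^ (-a)) =
      logDeriv Real.Gamma a - logDeriv Real.Gamma b := by
  refine tendsto_nhds_unique (tendsto_integral_filter_of_dominated_convergence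
    (l := 𝓝[>] 0)
    (F := fun ε t => t ^ (b - 1) * (1 + t) ^ (-(b + ε)) - t ^ (a - 1) * (1 + t) ^ (-(a + ε)))
    _ (Eventually.of_forall fun ε => Measurable.aestronglyMeasurable (by fun_prop)) ?_
    (integrableOn_rpow_mul_one_add_rpow_neg_sub ha hb hab).norm ?_)
    ((tendsto_beta_sub_beta ha hb).congr' ?_)
  · filter_upwards [self_mem_nhdsWithin] with ε (hε : 0 < ε)
    refine ae_restrict_of_forall_mem measurableSet_Ioi fun t (ht : 0 < t) => ?_
    have ht1 : 0 < 1 + t := by positivity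
    rw [neg_add, neg_add, Real.rpow_add ht1, Real.rpow_add ht1, ← mul_assoc, ← mul_assoc,
      ← sub_mul, norm_mul, Real.norm_of_nonneg (by positivity : 0 ≤ (1 + t) ^ (-ε))]
    exact mul_le_of_le_one_right (norm_nonneg _)
      (Real.rpow_le_one_of_one_le_of_nonpos (by linarith) (by linarith))
  · refine ae_restrict_of_forall_mem measurableSet_Ioi fun t (ht : 0 < t) => ?_
    have hcont : Continuous fun ε : ℝ =>
        t ^ (b - 1) * (1 + t) ^ (-(b + ε)) - t ^ (a - 1) * (1 + t) ^ (-(a + ε)) := by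
      have ht1 : 1 + t ≠ 0 := by positivity
      fun_prop (disch := assumption)
    simpa using (hcont.tendsto 0).mono_left nhdsWithin_le_nhds
  · filter_upwards [self_mem_nhdsWithin] with ε (hε : 0 < ε)
    rw [integral_sub (integrableOn_rpow_mul_one_add_rpow hb hε)
      (integrableOn_rpow_mul_one_add_rpow ha hε), integral_rpow_mul_one_add_rpow hb hε,
      integral_rpow_mul_one_add_rpow ha hε]

theorem logDeriv_Gamma_sub_logDeriv_Gamma_one_sub (hb : ∀ n : ℤ, b ≠ n) :
    logDeriv Real.Gamma (1 - b) - logDeriv Real.Gamma b = Real.pi * Real.cot (Real.pi * b) := by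
  have hd (c : ℝ) (hc : ∀ n : ℤ, c ≠ n) : DifferentiableAt ℝ Real.Gamma c ∧ Real.Gamma c ≠ 0 :=
    ⟨Real.differentiableAt_Gamma fun m => by exact_mod_cast hc (-m),
      Real.Gamma_ne_zero fun m => by exact_mod_cast hc (-m)⟩
  obtain ⟨hdb, hb0⟩ := hd b hb
  obtain ⟨hdb', hb0'⟩ := hd (1 - b) fun n h => hb (1 - n) (by push_cast; linarith)
  have hreflect : logDeriv (fun x => Real.Gamma x * Real.Gamma (1 - x)) b =
      logDeriv (fun x => Real.pi / Real.sin (Real.pi * x)) b :=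
    congr_arg (logDeriv · b) (funext Real.Gamma_mul_Gamma_one_sub)
  have hsin : Real.sin (Real.pi * b) ≠ 0 := fun h => by
    obtain ⟨n, hn⟩ := Real.sin_eq_zero_iff.1 h
    exact hb n (mul_right_cancel₀ Real.pi_ne_zero (by linarith))
  have hsub : DifferentiableAt ℝ (fun x : ℝ => 1 - x) b := by fun_prop
  have hΓ : logDeriv (fun x => Real.Gamma (1 - x)) b = -logDeriv Real.Gamma (1 - b) := by
    simpa [Function.comp_def, deriv_const_sub] using logDeriv_comp (f := Real.Gamma) hdb' hsub
  have hcot : logDeriv (fun x => Real.sin (Real.pi * x)) b =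
      Real.pi * Real.cot (Real.pi * b) := by
    have hcomp := logDeriv_comp (f := Real.sin) (g := fun x => Real.pi * x) (x := b)
      Real.differentiableAt_sin (by fun_prop)
    rw [Real.logDeriv_sin, deriv_const_mul_id', mul_comm] at hcomp
    exact hcomp
  rw [logDeriv_mul (f := Real.Gamma) (g := fun x => Real.Gamma (1 - x)) b hb0 hb0' hdb
      (hdb'.comp b hsub),
    logDeriv_div (f := fun _ => Real.pi) b Real.pi_ne_zero hsin (by fun_prop) (by fun_prop),
    logDeriv_const, hΓ, hcot, Pi.zero_apply] at hreflect
  linarith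

end BetaIntegral

/-- The integral `∫₀^∞ (x + y)^(c-1) y^(b-1) e^(-s y) dy`, a confluent hypergeometric function of
`s x` up to elementary factors; it carries the behaviour of the density at zero. -/
noncomputable def shiftedGammaIntegral (s c b x : ℝ) : ℝ :=
  ∫ y in Set.Ioi 0, (x + y) ^ (c - 1) * y ^ (b - 1) * Real.exp (-(s * y))

section ShiftedGammaIntegral

variable {s a b c x : ℝ}

theorem integrableOn_rpow_mul_exp_neg_mul (hs : 0 < s) (hb : 0 < b) :
    IntegrableOn (fun y : ℝ => y ^ (b - 1) * Real.exp (-(s * y))) (Set.Ioi 0) := by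
  simpa using integrableOn_rpow_mul_exp_neg_mul_rpow (p := 1) (s := b - 1) (by linarith)
    one_pos hs

theorem measurable_shiftedGammaIntegrand (s c b x : ℝ) :
    Measurable fun y : ℝ => (x + y) ^ (c - 1) * y ^ (b - 1) * Real.exp (-(s * y)) := by
  fun_prop

theorem integrableOn_shiftedGammaIntegrand (hs : 0 < s) (c : ℝ) (hb : 0 < b) (hx : 0 < x) :
    IntegrableOn (fun y : ℝ => (x + y) ^ (c - 1) * y ^ (b - 1) * Real.exp (-(s * y)))
      (Set.Ioi 0) := by
  have hbound : ∃ K m : ℝ, 0 ≤ m ∧ ∀ y, 0 < y → (x + y) ^ (c - 1) ≤ K + 2 ^ m * y ^ m := by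
    rcases le_total (c - 1) 0 with hc | hc
    · refine ⟨x ^ (c - 1), 0, le_rfl, fun y hy => ?_⟩
      exact (Real.rpow_le_rpow_of_nonpos hx (by linarith) hc).trans
        (le_add_of_nonneg_right (by positivity))
    · refine ⟨(2 * x) ^ (c - 1), c - 1, hc, fun y hy => ?_⟩
      rw [← Real.mul_rpow two_pos.le hy.le]
      have hx0 : 0 ≤ (2 * x) ^ (c - 1) := by positivity
      have hy0 : 0 ≤ (2 * y) ^ (c - 1) := by positivity
      rcases le_total x y with hxy | hxy
      · exact (Real.rpow_le_rpow (by positivity) (by linarith) hc).trans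
          (le_add_of_nonneg_left hx0)
      · exact (Real.rpow_le_rpow (by positivity) (by linarith) hc).trans
          (le_add_of_nonneg_right hy0)
  obtain ⟨K, m, hm, hbound⟩ := hbound
  have hdom := ((integrableOn_rpow_mul_exp_neg_mul hs hb).const_mul K).add
    ((integrableOn_rpow_mul_exp_neg_mul hs (add_pos_of_nonneg_of_pos hm hb)).const_mul (2 ^ m))
  refine hdom.mono' (measurable_shiftedGammaIntegrand s c b x).aestronglyMeasurable
    (ae_restrict_of_forall_mem measurableSet_Ioi fun y (hy : 0 < y) => ?_)
  rw [Real.norm_of_nonneg (by positivity)]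
  calc (x + y) ^ (c - 1) * y ^ (b - 1) * Real.exp (-(s * y))
      ≤ (K + 2 ^ m * y ^ m) * y ^ (b - 1) * Real.exp (-(s * y)) := by gcongr; exact hbound y hy
    _ = K * (y ^ (b - 1) * Real.exp (-(s * y)))
        + 2 ^ m * (y ^ (m + b - 1) * Real.exp (-(s * y))) := by
      rw [add_sub_assoc, Real.rpow_add hy]
      ring

theorem hasDerivAt_shiftedGammaIntegral (hs : 0 < s) (c : ℝ) (hb : 0 < b) (hx : 0 < x) :
    HasDerivAt (shiftedGammaIntegral s c b) ((c - 1) * shiftedGammaIntegral s (c - 1) b x) x := by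
  have hx2 : 0 < x / 2 := half_pos hx
  have hderiv := (hasDerivAt_integral_of_dominated_loc_of_deriv_le
    (μ := volume.restrict (Set.Ioi (0 : ℝ)))
    (F := fun t y => (t + y) ^ (c - 1) * y ^ (b - 1) * Real.exp (-(s * y)))
    (F' := fun t y => (c - 1) * ((t + y) ^ (c - 1 - 1) * y ^ (b - 1) * Real.exp (-(s * y))))
    (bound := fun y => |c - 1| * ((x / 2 + y) ^ (c - 1 - 1) * y ^ (b - 1) * Real.exp (-(s * y))
      + (2 * x + y) ^ (c - 1 - 1) * y ^ (b - 1) * Real.exp (-(s * y))))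
    (Ioo_mem_nhds (half_lt_self hx) (by linarith : x < 2 * x))
    (Eventually.of_forall fun t => (measurable_shiftedGammaIntegrand s c b t).aestronglyMeasurable)
    (integrableOn_shiftedGammaIntegrand hs c hb hx)
    ((measurable_shiftedGammaIntegrand s (c - 1) b x).const_mul _).aestronglyMeasurable
    (ae_restrict_of_forall_mem measurableSet_Ioi fun y (hy : 0 < y) t ht => ?_)
    (((integrableOn_shiftedGammaIntegrand hs (c - 1) hb hx2).add
      (integrableOn_shiftedGammaIntegrand hs (c - 1) hb (by positivity))).const_mul _)
    (ae_restrict_of_forall_mem measurableSet_Ioi fun y (hy : 0 < y) t ht => ?_)).2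
  · rwa [integral_const_mul] at hderiv
  · have ht0 : 0 < t := hx2.trans ht.1
    rw [norm_mul, Real.norm_eq_abs, Real.norm_of_nonneg (by positivity), ← add_mul, ← add_mul]
    gcongr
    exact rpow_le_rpow_add_rpow_of_mem_Icc (by positivity)
      ⟨by linarith [ht.1], by linarith [ht.2]⟩ _
  · have ht0 : 0 < t := hx2.trans ht.1
    exact (((((hasDerivAt_id t).add_const y).rpow_const (p := c - 1)
      (Or.inl (add_pos ht0 hy).ne')).mul_const _).mul_const _).congr_deriv (by simp only [id]; ring)

theorem shiftedGammaIntegral_by_parts (hs : 0 < s) (c : ℝ) (hb : 1 < b) (hx : 0 < x) :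
    (c - 1) * shiftedGammaIntegral s (c - 1) b x =
      s * shiftedGammaIntegral s c b x - (b - 1) * shiftedGammaIntegral s c (b - 1) x := by
  have hb0 : 0 < b := one_pos.trans hb
  set F := fun y : ℝ => (x + y) ^ (c - 1) * y ^ (b - 1) * Real.exp (-(s * y)) with hF
  have hint₁ := (integrableOn_shiftedGammaIntegrand hs (c - 1) hb0 hx).const_mul (c - 1)
  have hint₂ := (integrableOn_shiftedGammaIntegrand hs c hb0 hx).const_mul s
  have hint₃ := (integrableOn_shiftedGammaIntegrand hs c (sub_pos.2 hb) hx).const_mul (b - 1)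
  have hcont : ContinuousWithinAt F (Set.Ici 0) 0 := by
    have hxc : ContinuousAt (fun y : ℝ => (x + y) ^ (c - 1)) 0 :=
      ContinuousAt.rpow_const (by fun_prop) (Or.inl (by simpa using hx.ne'))
    have hyb : ContinuousAt (fun y : ℝ => y ^ (b - 1)) 0 :=
      Real.continuousAt_rpow_const _ _ (Or.inr (sub_pos.2 hb).le)
    exact ((hxc.mul hyb).mul (by fun_prop)).continuousWithinAt
  have hderiv : ∀ y ∈ Set.Ioi (0 : ℝ), HasDerivAt F
      ((c - 1) * ((x + y) ^ (c - 1 - 1) * y ^ (b - 1) * Real.exp (-(s * y)))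
        - s * ((x + y) ^ (c - 1) * y ^ (b - 1) * Real.exp (-(s * y)))
        + (b - 1) * ((x + y) ^ (c - 1) * y ^ (b - 1 - 1) * Real.exp (-(s * y)))) y := by
    intro y (hy : 0 < y)
    have hxc := ((hasDerivAt_id' y).const_add x).rpow_const (p := c - 1)
      (Or.inl (add_pos hx hy).ne')
    have hyb := (hasDerivAt_id' y).rpow_const (p := b - 1) (Or.inl hy.ne')
    have hexp := ((hasDerivAt_id' y).const_mul s).fun_neg.exp
    exact ((hxc.mul hyb).mul hexp).congr_deriv (by simp only [Pi.mul_apply]; ring)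
  have hint := (hint₁.sub hint₂).add hint₃
  have hlim : Tendsto F atTop (𝓝 0) :=
    tendsto_zero_of_hasDerivAt_of_integrableOn_Ioi hderiv hint
      (integrableOn_shiftedGammaIntegrand hs c hb0 hx)
  have hF0 : F 0 = 0 := by simp [hF, Real.zero_rpow (sub_pos.2 hb).ne']
  have hFTC := integral_Ioi_of_hasDerivAt_of_tendsto hcont hderiv hint hlim
  rw [integral_add (hint₁.sub' hint₂) hint₃, integral_sub hint₁ hint₂, integral_const_mul,
    integral_const_mul, integral_const_mul, hF0] at hFTC
  simp only [shiftedGammaIntegral]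
  linarith

theorem tendsto_shiftedGammaIntegral (hs : 0 < s) (hb : 0 < b) (hcb : 1 < c + b) :
    Tendsto (shiftedGammaIntegral s c b) (𝓝[>] 0)
      (𝓝 ((1 / s) ^ (c + b - 1) * Real.Gamma (c + b - 1))) := by
  have hpow : ∀ y : ℝ, 0 < y → y ^ (c + b - 1 - 1) = y ^ (c - 1) * y ^ (b - 1) := fun y hy => by
    rw [← Real.rpow_add hy]
    ring_nf
  rw [← Real.integral_rpow_mul_exp_neg_mul_Ioi (sub_pos.2 hcb) hs]
  refine tendsto_integral_filter_of_dominated_convergence _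
    (Eventually.of_forall fun t => (measurable_shiftedGammaIntegrand s c b t).aestronglyMeasurable)
    ?_ ((integrableOn_rpow_mul_exp_neg_mul hs (sub_pos.2 hcb)).add
      (integrableOn_shiftedGammaIntegrand hs c hb one_pos)) ?_
  · filter_upwards [Ioo_mem_nhdsGT one_pos] with x hx
    refine ae_restrict_of_forall_mem measurableSet_Ioi fun y (hy : 0 < y) => ?_
    have hx0 := hx.1
    rw [Real.norm_of_nonneg (by positivity), Pi.add_apply, hpow y hy, ← add_mul, ← add_mul]
    gcongr
    exact rpow_le_rpow_add_rpow_of_mem_Icc hy ⟨by linarith, by linarith [hx.2]⟩ _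
  · refine ae_restrict_of_forall_mem measurableSet_Ioi fun y (hy : 0 < y) => ?_
    have hcont : ContinuousAt
        (fun x : ℝ => (x + y) ^ (c - 1) * y ^ (b - 1) * Real.exp (-(s * y))) 0 :=
      ((ContinuousAt.rpow_const (by fun_prop) (Or.inl (by simpa using hy.ne'))).mul
        continuousAt_const).mul continuousAt_const
    rw [hpow y hy]
    simpa using hcont.tendsto.mono_left nhdsWithin_le_nhds

theorem shiftedGammaIntegral_eq_rpow_mul (s c b : ℝ) (hx : 0 < x) :
    shiftedGammaIntegral s c b x = x ^ (c + b - 1) * shiftedGammaIntegral (s * x) c b 1 := by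
  have hscale := integral_comp_mul_left_Ioi'
    (fun y => (x + y) ^ (c - 1) * y ^ (b - 1) * Real.exp (-(s * y))) 0 hx
  rw [mul_zero] at hscale
  rw [shiftedGammaIntegral, shiftedGammaIntegral, ← hscale, smul_eq_mul, ← integral_const_mul,
    ← integral_const_mul]
  refine setIntegral_congr_fun measurableSet_Ioi fun t (ht : 0 < t) => ?_
  have hpow : x ^ (c + b - 1) = x * x ^ (c - 1) * x ^ (b - 1) := by
    rw [← rpow_eq_mul_rpow_sub_one hx, ← Real.rpow_add hx, add_sub_assoc]
  rw [← mul_one_add x t, Real.mul_rpow hx.le (by positivity), Real.mul_rpow hx.le ht.le, hpow,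
    mul_assoc s x t]
  ring

theorem tendsto_const_mul_nhdsGT_zero (hs : 0 < s) :
    Tendsto (fun x => s * x) (𝓝[>] 0) (𝓝[>] 0) :=
  tendsto_nhdsWithin_iff.2 ⟨by simpa using
    ((continuous_const_mul s).tendsto 0).mono_left nhdsWithin_le_nhds,
    eventually_mem_nhdsWithin.mono fun _ hx => mul_pos hs hx⟩

theorem tendsto_shiftedGammaIntegral_div_rpow (hs : 0 < s) (hb : 0 < b) (hcb : c + b < 1) :
    Tendsto (fun x => shiftedGammaIntegral s c b x / x ^ (c + b - 1)) (𝓝[>] 0)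
      (𝓝 (beta b (1 - c - b))) := by
  have hexp : -(b + (1 - c - b)) = c - 1 := by ring
  have hq : 0 < 1 - c - b := by linarith
  have hint := integrableOn_rpow_mul_one_add_rpow hb hq
  have hval := integral_rpow_mul_one_add_rpow hb hq
  rw [hexp] at hint hval
  rw [← hval]
  refine ((tendsto_integral_mul_exp_neg_mul hint).comp
    (tendsto_const_mul_nhdsGT_zero hs)).congr' ?_
  filter_upwards [self_mem_nhdsWithin] with x (hx : 0 < x)
  rw [shiftedGammaIntegral_eq_rpow_mul s c b hx, mul_div_cancel_left₀ _ (by positivity),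
    shiftedGammaIntegral]
  simp only [Function.comp_apply, mul_comm (_ ^ (b - 1))]

-- The derivative of the integral is `-b` times an integral to which the power law applies.
theorem tendsto_shiftedGammaIntegral_div_neg_log (hs : 0 < s) (hb : 0 < b) (hcb : c + b = 1) :
    Tendsto (fun x => shiftedGammaIntegral s c b x / -Real.log x) (𝓝[>] 0) (𝓝 1) := by
  have hΓ : (c - 1) * beta b (1 - (c - 1) - b) = -1 := by
    rw [beta, show 1 - (c - 1) - b = 1 by linarith, show c - 1 = -b by linarith,
      Real.Gamma_add_one hb.ne', Real.Gamma_one]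
    have := (Real.Gamma_pos_of_pos hb).ne'
    field_simp
  have hlim : Tendsto (fun x => x * ((c - 1) * shiftedGammaIntegral s (c - 1) b x)) (𝓝[>] 0)
      (𝓝 (-1)) := by
    rw [← hΓ]
    refine ((tendsto_shiftedGammaIntegral_div_rpow hs hb
      (by linarith : c - 1 + b < 1)).const_mul (c - 1)).congr fun x => ?_
    rw [show c - 1 + b - 1 = -1 by linarith, Real.rpow_neg_one, div_inv_eq_mul]
    ring
  have hlog := tendsto_div_log_of_tendsto_mul_deriv (eventually_mem_nhdsWithin.mono
    fun x (hx : 0 < x) => hasDerivAt_shiftedGammaIntegral hs c hb hx) hlim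
  simpa only [div_neg, neg_neg] using hlog.neg

theorem tendsto_shiftedGammaIntegral_sub_swap (hs : 0 < s) (ha : 0 < a) (hb : 0 < b)
    (hab : a + b = 1) :
    Tendsto (fun x => shiftedGammaIntegral s a b x - shiftedGammaIntegral s b a x) (𝓝[>] 0)
      (𝓝 (Real.pi * Real.cot (Real.pi * b))) := by
  have hdist : |a - b| ≤ 1 := abs_le.2 ⟨by linarith, by linarith⟩
  have hnotint (n : ℤ) : b ≠ n := fun h => by
    have h0 : (0 : ℝ) < n := h ▸ hb
    have h1 : (n : ℝ) < 1 := by linarith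
    norm_cast at h0 h1
    lia
  rw [← logDeriv_Gamma_sub_logDeriv_Gamma_one_sub hnotint, show 1 - b = a by linarith,
    ← integral_rpow_mul_one_add_rpow_neg_sub ha hb hdist]
  refine ((tendsto_integral_mul_exp_neg_mul
    (integrableOn_rpow_mul_one_add_rpow_neg_sub ha hb hdist)).comp
    (tendsto_const_mul_nhdsGT_zero hs)).congr' ?_
  filter_upwards [self_mem_nhdsWithin] with x (hx : 0 < x)
  rw [shiftedGammaIntegral_eq_rpow_mul s a b hx, shiftedGammaIntegral_eq_rpow_mul s b a hx,
    add_comm b a, hab, sub_self, Real.rpow_zero, one_mul, one_mul, shiftedGammaIntegral,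
    shiftedGammaIntegral, ← integral_sub
      (integrableOn_shiftedGammaIntegrand (mul_pos hs hx) a hb one_pos)
      (integrableOn_shiftedGammaIntegrand (mul_pos hs hx) b ha one_pos)]
  simp only [Function.comp_apply, show -b = a - 1 by linarith, show -a = b - 1 by linarith,
    sub_mul, mul_comm (_ ^ (b - 1))]

end ShiftedGammaIntegral

section Density

variable {a lp b lm c x : ℝ} {n : ℕ}

theorem tendsto_exp_neg_mul_nhdsGT_zero (r : ℝ) :
    Tendsto (fun x : ℝ => Real.exp (-(r * x))) (𝓝[>] 0) (𝓝 1) := by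
  have hcont : Continuous fun x : ℝ => Real.exp (-(r * x)) := by fun_prop
  simpa using (hcont.tendsto 0).mono_left nhdsWithin_le_nhds

-- If `c - 1` is a pole of `Γ`, both sides vanish because `Real.Gamma` is `0` there and `x / 0 = 0`.
theorem rpow_div_Gamma_mul_sub_one {r : ℝ} (hr : 0 < r) (c : ℝ) :
    r ^ c / Real.Gamma c * (c - 1) = r * (r ^ (c - 1) / Real.Gamma (c - 1)) := by
  rcases eq_or_ne c 1 with rfl | hc
  · simp
  · have hc' : c - 1 ≠ 0 := sub_ne_zero.2 hc
    have hΓ : Real.Gamma c = (c - 1) * Real.Gamma (c - 1) := by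
      simpa using Real.Gamma_add_one hc'
    rw [hΓ, rpow_eq_mul_rpow_sub_one hr c]
    field_simp

theorem div_Gamma_one_sub_mul_div_Gamma (u v b : ℝ) :
    u / Real.Gamma (1 - b) * (v / Real.Gamma b) = u * v * (Real.sin (Real.pi * b) / Real.pi) := by
  rw [div_mul_div_comm, mul_comm (Real.Gamma (1 - b)), Real.Gamma_mul_Gamma_one_sub,
    div_div_eq_mul_div, mul_div_assoc]

theorem bilateralGammaPDF_eq (c lp b lm : ℝ) (hx : 0 < x) :
    bilateralGammaPDF c lp b lm x = lp ^ c / Real.Gamma c * (lm ^ b / Real.Gamma b) *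
      (Real.exp (-(lp * x)) * shiftedGammaIntegral (lp + lm) c b x) := by
  have hintegrand (y : ℝ) : gammaPDFReal c lp (x + y) * gammaPDFReal b lm y =
      (Set.Ici (0 : ℝ)).indicator (fun y => lp ^ c / Real.Gamma c * (lm ^ b / Real.Gamma b) *
        Real.exp (-(lp * x)) *
          ((x + y) ^ (c - 1) * y ^ (b - 1) * Real.exp (-((lp + lm) * y)))) y := by
    by_cases hy : 0 ≤ y
    · rw [Set.indicator_of_mem (Set.mem_Ici.2 hy), gammaPDFReal, gammaPDFReal, if_pos hy,
        if_pos (by positivity), show -((lp + lm) * y) = -(lp * y) + -(lm * y) by ring,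
        Real.exp_add, show -(lp * (x + y)) = -(lp * x) + -(lp * y) by ring, Real.exp_add]
      ring
    · rw [Set.indicator_of_notMem (by simpa using hy), gammaPDFReal, gammaPDFReal, if_neg hy,
        mul_zero]
  simp only [bilateralGammaPDF, hintegrand]
  rw [integral_indicator measurableSet_Ici, integral_Ici_eq_integral_Ioi, integral_const_mul,
    shiftedGammaIntegral, mul_assoc]

theorem bilateralGammaPDF_neg (a lp b lm x : ℝ) :
    bilateralGammaPDF a lp b lm (-x) = bilateralGammaPDF b lm a lp x := by
  rw [bilateralGammaPDF, bilateralGammaPDF, ← integral_add_right_eq_self _ x]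
  simp only [add_comm _ x, neg_add_cancel_left, mul_comm]

theorem bilateralGammaPDF_eq_comp_neg (a lp b lm : ℝ) :
    bilateralGammaPDF a lp b lm = fun x => bilateralGammaPDF b lm a lp (-x) :=
  funext fun x => (bilateralGammaPDF_neg b lm a lp x).symm

theorem bilateralGammaPDF_eq_zero (m : ℕ) (lp b lm : ℝ) :
    bilateralGammaPDF (-m) lp b lm = 0 := by
  funext x
  simp [bilateralGammaPDF, gammaPDFReal, Real.Gamma_neg_nat_eq_zero]

theorem hasDerivAt_bilateralGammaPDF_of_pos (hlp : 0 < lp) (hb : 0 < b) (hlm : 0 < lm) (c : ℝ)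
    (hx : 0 < x) :
    HasDerivAt (bilateralGammaPDF c lp b lm)
      (lp * (bilateralGammaPDF (c - 1) lp b lm x - bilateralGammaPDF c lp b lm x)) x := by
  have hexp := ((hasDerivAt_id' x).const_mul lp).fun_neg.exp
  have hint := hasDerivAt_shiftedGammaIntegral (add_pos hlp hlm) c hb hx
  refine (((hexp.fun_mul hint).const_mul
    (lp ^ c / Real.Gamma c * (lm ^ b / Real.Gamma b))).congr_deriv ?_).congr_of_eventuallyEq
    ((eventually_gt_nhds hx).mono fun t ht => bilateralGammaPDF_eq c lp b lm ht)
  rw [bilateralGammaPDF_eq (c - 1) lp b lm hx, bilateralGammaPDF_eq c lp b lm hx]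
  linear_combination (lm ^ b / Real.Gamma b) * Real.exp (-(lp * x)) *
    shiftedGammaIntegral (lp + lm) (c - 1) b x * rpow_div_Gamma_mul_sub_one hlp c

theorem hasDerivAt_bilateralGammaPDF_of_pos_of_one_lt (hlp : 0 < lp) (hb : 1 < b) (hlm : 0 < lm)
    (c : ℝ) (hx : 0 < x) :
    HasDerivAt (bilateralGammaPDF c lp b lm)
      (lm * (bilateralGammaPDF c lp b lm x - bilateralGammaPDF c lp (b - 1) lm x)) x := by
  refine (hasDerivAt_bilateralGammaPDF_of_pos hlp (by linarith) hlm c hx).congr_deriv ?_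
  rw [bilateralGammaPDF_eq (c - 1) lp b lm hx, bilateralGammaPDF_eq c lp b lm hx,
    bilateralGammaPDF_eq c lp (b - 1) lm hx]
  linear_combination -((lm ^ b / Real.Gamma b) * Real.exp (-(lp * x)) *
      shiftedGammaIntegral (lp + lm) (c - 1) b x * rpow_div_Gamma_mul_sub_one hlp c)
    - (lp ^ c / Real.Gamma c) * Real.exp (-(lp * x)) *
      shiftedGammaIntegral (lp + lm) c (b - 1) x * rpow_div_Gamma_mul_sub_one hlm b
    + lp ^ c / Real.Gamma c * (lm ^ b / Real.Gamma b) * Real.exp (-(lp * x)) *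
      shiftedGammaIntegral_by_parts (add_pos hlp hlm) c hb hx

theorem hasDerivAt_bilateralGammaPDF_left (ha : 1 < a) (hlp : 0 < lp) (hb : 0 < b) (hlm : 0 < lm)
    (hx : x ≠ 0) :
    HasDerivAt (bilateralGammaPDF a lp b lm)
      (lp * (bilateralGammaPDF (a - 1) lp b lm x - bilateralGammaPDF a lp b lm x)) x := by
  rcases hx.lt_or_gt with hx | hx
  · rw [bilateralGammaPDF_eq_comp_neg a, bilateralGammaPDF_eq_comp_neg (a - 1)]
    exact ((hasDerivAt_bilateralGammaPDF_of_pos_of_one_lt hlm ha hlp b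
      (neg_pos.2 hx)).scomp x (hasDerivAt_neg x)).congr_deriv (by simp only [smul_eq_mul]; ring)
  · exact hasDerivAt_bilateralGammaPDF_of_pos hlp hb hlm a hx

theorem hasDerivAt_bilateralGammaPDF_right (ha : 0 < a) (hlp : 0 < lp) (hb : 1 < b) (hlm : 0 < lm)
    (hx : x ≠ 0) :
    HasDerivAt (bilateralGammaPDF a lp b lm)
      (lm * (bilateralGammaPDF a lp b lm x - bilateralGammaPDF a lp (b - 1) lm x)) x := by
  rw [bilateralGammaPDF_eq_comp_neg a lp b, bilateralGammaPDF_eq_comp_neg a lp (b - 1)]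
  exact ((hasDerivAt_bilateralGammaPDF_left hb hlm ha hlp (neg_ne_zero.2 hx)).scomp x
    (hasDerivAt_neg x)).congr_deriv (by simp only [smul_eq_mul]; ring)

theorem contDiffOn_Ioi_bilateralGammaPDF (hlp : 0 < lp) (hb : 0 < b) (hlm : 0 < lm) (n : ℕ)
    (c : ℝ) : ContDiffOn ℝ n (bilateralGammaPDF c lp b lm) (Set.Ioi 0) := by
  have hderiv (c x : ℝ) (hx : x ∈ Set.Ioi 0) :=
    hasDerivAt_bilateralGammaPDF_of_pos hlp hb hlm c hx
  induction n generalizing c with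
  | zero => exact contDiffOn_zero.2 fun x hx => (hderiv c x hx).continuousAt.continuousWithinAt
  | succ n ih =>
    rw [Nat.cast_succ, contDiffOn_succ_iff_deriv_of_isOpen isOpen_Ioi]
    exact ⟨fun x hx => (hderiv c x hx).differentiableAt.differentiableWithinAt, by simp,
      (contDiffOn_const.mul ((ih (c - 1)).sub (ih c))).congr fun x hx => (hderiv c x hx).deriv⟩

theorem contDiffAt_bilateralGammaPDF_of_pos (hlp : 0 < lp) (hb : 0 < b) (hlm : 0 < lm) (n : ℕ)
    (c : ℝ) (hx : 0 < x) : ContDiffAt ℝ n (bilateralGammaPDF c lp b lm) x :=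
  (contDiffOn_Ioi_bilateralGammaPDF hlp hb hlm n c).contDiffAt (Ioi_mem_nhds hx)

theorem contDiffAt_bilateralGammaPDF (ha : 0 < a) (hlp : 0 < lp) (hb : 0 < b) (hlm : 0 < lm)
    (n : ℕ) (hx : x ≠ 0) : ContDiffAt ℝ n (bilateralGammaPDF a lp b lm) x := by
  rcases hx.lt_or_gt with hx | hx
  · rw [bilateralGammaPDF_eq_comp_neg]
    exact (contDiffAt_bilateralGammaPDF_of_pos hlm ha hlp n b (neg_pos.2 hx)).comp x
      contDiff_neg.contDiffAt
  · exact contDiffAt_bilateralGammaPDF_of_pos hlp hb hlm n a hx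

theorem iteratedDeriv_succ_of_hasDerivAt_mul_sub {f g h : ℝ → ℝ} {k : ℝ}
    (hf : ∀ᶠ t in 𝓝 x, HasDerivAt f (k * (g t - h t)) t)
    (hg : ContDiffAt ℝ n g x) (hh : ContDiffAt ℝ n h x) :
    iteratedDeriv (n + 1) f x = k * (iteratedDeriv n g x - iteratedDeriv n h x) := by
  have hderiv : deriv f =ᶠ[𝓝 x] fun t => k * (g t - h t) := hf.mono fun t ht => ht.deriv
  rw [iteratedDeriv_succ', hderiv.iteratedDeriv_eq, iteratedDeriv_const_mul_field,
    iteratedDeriv_fun_sub hg hh]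

theorem iteratedDeriv_succ_bilateralGammaPDF_of_pos (hlp : 0 < lp) (hb : 0 < b) (hlm : 0 < lm)
    (n : ℕ) (c : ℝ) (hx : 0 < x) :
    iteratedDeriv (n + 1) (bilateralGammaPDF c lp b lm) x =
      lp * (iteratedDeriv n (bilateralGammaPDF (c - 1) lp b lm) x
        - iteratedDeriv n (bilateralGammaPDF c lp b lm) x) :=
  iteratedDeriv_succ_of_hasDerivAt_mul_sub
    ((eventually_gt_nhds hx).mono fun _ => hasDerivAt_bilateralGammaPDF_of_pos hlp hb hlm c)
    (contDiffAt_bilateralGammaPDF_of_pos hlp hb hlm n _ hx)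
    (contDiffAt_bilateralGammaPDF_of_pos hlp hb hlm n _ hx)

theorem iteratedDeriv_succ_bilateralGammaPDF_left (ha : 1 < a) (hlp : 0 < lp) (hb : 0 < b)
    (hlm : 0 < lm) (n : ℕ) (hx : x ≠ 0) :
    iteratedDeriv (n + 1) (bilateralGammaPDF a lp b lm) x =
      lp * (iteratedDeriv n (bilateralGammaPDF (a - 1) lp b lm) x
        - iteratedDeriv n (bilateralGammaPDF a lp b lm) x) :=
  iteratedDeriv_succ_of_hasDerivAt_mul_sub
    ((eventually_ne_nhds hx).mono fun _ => hasDerivAt_bilateralGammaPDF_left ha hlp hb hlm)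
    (contDiffAt_bilateralGammaPDF (sub_pos.2 ha) hlp hb hlm n hx)
    (contDiffAt_bilateralGammaPDF (one_pos.trans ha) hlp hb hlm n hx)

theorem iteratedDeriv_succ_bilateralGammaPDF_right (ha : 0 < a) (hlp : 0 < lp) (hb : 1 < b)
    (hlm : 0 < lm) (n : ℕ) (hx : x ≠ 0) :
    iteratedDeriv (n + 1) (bilateralGammaPDF a lp b lm) x =
      lm * (iteratedDeriv n (bilateralGammaPDF a lp b lm) x
        - iteratedDeriv n (bilateralGammaPDF a lp (b - 1) lm) x) :=
  iteratedDeriv_succ_of_hasDerivAt_mul_sub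
    ((eventually_ne_nhds hx).mono fun _ => hasDerivAt_bilateralGammaPDF_right ha hlp hb hlm)
    (contDiffAt_bilateralGammaPDF ha hlp (one_pos.trans hb) hlm n hx)
    (contDiffAt_bilateralGammaPDF ha hlp (sub_pos.2 hb) hlm n hx)

end Density

section AtZero

variable {lp b lm c : ℝ} {n : ℕ}

theorem tendsto_bilateralGammaPDF_div_of_tendsto {g : ℝ → ℝ} {L : ℝ}
    (h : Tendsto (fun x => shiftedGammaIntegral (lp + lm) c b x / g x) (𝓝[>] 0) (𝓝 L)) :
    Tendsto (fun x => bilateralGammaPDF c lp b lm x / g x) (𝓝[>] 0)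
      (𝓝 (lp ^ c / Real.Gamma c * (lm ^ b / Real.Gamma b) * L)) := by
  have hlim := ((tendsto_exp_neg_mul_nhdsGT_zero lp).mul h).const_mul
    (lp ^ c / Real.Gamma c * (lm ^ b / Real.Gamma b))
  rw [one_mul] at hlim
  refine hlim.congr' ?_
  filter_upwards [self_mem_nhdsWithin] with x hx
  rw [bilateralGammaPDF_eq c lp b lm hx]
  ring

theorem tendsto_bilateralGammaPDF (hlp : 0 < lp) (hb : 0 < b) (hlm : 0 < lm) (hcb : 1 < c + b) :
    Tendsto (bilateralGammaPDF c lp b lm) (𝓝[>] 0)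
      (𝓝 (lp ^ c / Real.Gamma c * (lm ^ b / Real.Gamma b) *
        ((1 / (lp + lm)) ^ (c + b - 1) * Real.Gamma (c + b - 1)))) := by
  have h := tendsto_shiftedGammaIntegral (add_pos hlp hlm) hb hcb
  simpa only [div_one] using tendsto_bilateralGammaPDF_div_of_tendsto (g := fun _ => 1)
    (by simpa only [div_one] using h)

theorem tendsto_bilateralGammaPDF_div_rpow (hlp : 0 < lp) (hb : 0 < b) (hlm : 0 < lm)
    (hcb : c + b < 1) :
    Tendsto (fun x => bilateralGammaPDF c lp b lm x / x ^ (c + b - 1)) (𝓝[>] 0)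
      (𝓝 (lp ^ c * lm ^ b * (Real.Gamma (1 - c - b) * (Real.sin (Real.pi * c) / Real.pi)))) := by
  convert tendsto_bilateralGammaPDF_div_of_tendsto
    (tendsto_shiftedGammaIntegral_div_rpow (add_pos hlp hlm) hb hcb) using 2
  have hΓb : Real.Gamma b ≠ 0 := (Real.Gamma_pos_of_pos hb).ne'
  have hsin : Real.sin (Real.pi * c) / Real.pi = 1 / Real.Gamma c * (1 / Real.Gamma (1 - c)) := by
    rw [one_div_mul_one_div, Real.Gamma_mul_Gamma_one_sub, one_div_div]
  rw [hsin, beta, show b + (1 - c - b) = 1 - c by ring]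
  field_simp

theorem tendsto_bilateralGammaPDF_div_neg_log (hlp : 0 < lp) (hb : 0 < b) (hlm : 0 < lm)
    (hcb : c + b = 1) :
    Tendsto (fun x => bilateralGammaPDF c lp b lm x / -Real.log x) (𝓝[>] 0)
      (𝓝 (lp ^ c * lm ^ b * (Real.sin (Real.pi * b) / Real.pi))) := by
  have h := tendsto_bilateralGammaPDF_div_of_tendsto
    (tendsto_shiftedGammaIntegral_div_neg_log (add_pos hlp hlm) hb hcb)
  obtain rfl : c = 1 - b := by linarith
  rwa [div_Gamma_one_sub_mul_div_Gamma, mul_one] at h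

-- Iterating `f_c' = lp * (f_(c-1) - f_c)`, only the term of smallest shape `c - n` can blow up.
theorem exists_tendsto_iteratedDeriv_bilateralGammaPDF_sub (hlp : 0 < lp) (hb : 0 < b)
    (hlm : 0 < lm) (hn : n < c + b) :
    ∃ l, Tendsto (fun x => iteratedDeriv n (bilateralGammaPDF c lp b lm) x
      - lp ^ n * bilateralGammaPDF (c - n) lp b lm x) (𝓝[>] 0) (𝓝 l) := by
  induction n generalizing c with
  | zero => exact ⟨0, by simp⟩
  | succ n ih =>
    push_cast at hn
    obtain ⟨l₁, hl₁⟩ := ih (by linarith : n < c - 1 + b)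
    obtain ⟨l₂, hl₂⟩ := ih (by linarith : n < c + b)
    have hbdd := (tendsto_bilateralGammaPDF hlp hb hlm (by linarith : 1 < c - n + b)).const_mul
      (lp ^ n)
    refine ⟨_, ((hl₁.sub (hl₂.add hbdd)).const_mul lp).congr' ?_⟩
    filter_upwards [self_mem_nhdsWithin] with x hx
    rw [iteratedDeriv_succ_bilateralGammaPDF_of_pos hlp hb hlm n c hx,
      show c - 1 - n = c - (n + 1 : ℕ) by push_cast; ring]
    ring

theorem tendsto_iteratedDeriv_bilateralGammaPDF_div (hlp : 0 < lp) (hb : 0 < b) (hlm : 0 < lm)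
    (hn : n < c + b) {g : ℝ → ℝ} {C : ℝ} (hg : Tendsto g (𝓝[>] 0) atTop)
    (h : Tendsto (fun x => bilateralGammaPDF (c - n) lp b lm x / g x) (𝓝[>] 0) (𝓝 C)) :
    Tendsto (fun x => iteratedDeriv n (bilateralGammaPDF c lp b lm) x / g x) (𝓝[>] 0)
      (𝓝 (lp ^ n * C)) := by
  obtain ⟨l, hl⟩ := exists_tendsto_iteratedDeriv_bilateralGammaPDF_sub hlp hb hlm hn
  refine (zero_add (lp ^ n * C) ▸ (hl.div_atTop hg).add (h.const_mul (lp ^ n))).congr fun x => ?_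
  ring

theorem tendsto_iteratedDeriv_bilateralGammaPDF_div_rpow (hlp : 0 < lp) (hb : 0 < b)
    (hlm : 0 < lm) (hn : n < c + b) (hn' : c + b < n + 1) :
    Tendsto (fun x => iteratedDeriv n (bilateralGammaPDF c lp b lm) x / x ^ (c + b - n - 1))
      (𝓝[>] 0) (𝓝 (lp ^ c * lm ^ b *
        (Real.Gamma (n + 1 - c - b) * (Real.sin (Real.pi * (c - n)) / Real.pi)))) := by
  have hg : Tendsto (fun x : ℝ => x ^ (c + b - n - 1)) (𝓝[>] 0) atTop :=
    tendsto_rpow_neg_nhdsGT_zero (by linarith)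
  have hpow : lp ^ c = lp ^ n * lp ^ (c - n) := by
    rw [← Real.rpow_natCast, ← Real.rpow_add hlp, add_sub_cancel]
  have h := tendsto_bilateralGammaPDF_div_rpow hlp hb hlm (by linarith : c - n + b < 1)
  rw [show c - n + b - 1 = c + b - n - 1 by ring,
    show 1 - (c - n) - b = n + 1 - c - b by ring] at h
  rw [hpow, mul_assoc (lp ^ n), mul_assoc (lp ^ n)]
  exact tendsto_iteratedDeriv_bilateralGammaPDF_div hlp hb hlm hn hg h

theorem tendsto_iteratedDeriv_bilateralGammaPDF_div_neg_log_nhdsGT (hlp : 0 < lp) (hb : 0 < b)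
    (hlm : 0 < lm) (hn : c + b = n + 1) :
    Tendsto (fun x => iteratedDeriv n (bilateralGammaPDF c lp b lm) x / -Real.log x)
      (𝓝[>] 0) (𝓝 (lp ^ c * lm ^ b * (Real.sin (Real.pi * b) / Real.pi))) := by
  have hpow : lp ^ c = lp ^ n * lp ^ (c - n) := by
    rw [← Real.rpow_natCast, ← Real.rpow_add hlp, add_sub_cancel]
  rw [hpow, mul_assoc (lp ^ n), mul_assoc (lp ^ n)]
  exact tendsto_iteratedDeriv_bilateralGammaPDF_div hlp hb hlm (by linarith)
    (tendsto_neg_atBot_atTop.comp Real.tendsto_log_nhdsGT_zero)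
    (tendsto_bilateralGammaPDF_div_neg_log hlp hb hlm (by linarith))

theorem exists_tendsto_iteratedDeriv_bilateralGammaPDF_natCast (hlp : 0 < lp) (hb : 0 < b)
    (hlm : 0 < lm) {m : ℕ} (hn : n < m + b) :
    ∃ l, Tendsto (iteratedDeriv n (bilateralGammaPDF m lp b lm)) (𝓝[>] 0) (𝓝 l) := by
  obtain ⟨l, hl⟩ := exists_tendsto_iteratedDeriv_bilateralGammaPDF_sub hlp hb hlm hn
  rcases le_or_gt m n with hmn | hmn
  · have hshape : (m : ℝ) - n = -(n - m : ℕ) := by push_cast [hmn]; ring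
    exact ⟨l, by simpa [hshape, bilateralGammaPDF_eq_zero] using hl⟩
  · have hone : (n : ℝ) + 1 ≤ m := by exact_mod_cast hmn
    have hbdd := tendsto_bilateralGammaPDF hlp hb hlm (by linarith : 1 < (m : ℝ) - n + b)
    exact ⟨_, by simpa only [sub_add_cancel] using hl.add (hbdd.const_mul (lp ^ n))⟩

end AtZero

section Jump

variable {a lp b lm x : ℝ} {n : ℕ}

/-- The difference `f⁽ⁿ⁾(x) - f⁽ⁿ⁾(-x)` for the bilateral Gamma density `f`; its limit as `x ↓ 0`
is the jump of the `n`-th derivative across zero. -/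
noncomputable def bilateralGammaJump (n : ℕ) (a lp b lm x : ℝ) : ℝ :=
  iteratedDeriv n (bilateralGammaPDF a lp b lm) x -
    iteratedDeriv n (bilateralGammaPDF a lp b lm) (-x)

theorem bilateralGammaJump_zero (a lp b lm x : ℝ) :
    bilateralGammaJump 0 a lp b lm x =
      bilateralGammaPDF a lp b lm x - bilateralGammaPDF b lm a lp x := by
  rw [bilateralGammaJump, iteratedDeriv_zero, bilateralGammaPDF_neg]

theorem bilateralGammaJump_succ_left (ha : 1 < a) (hlp : 0 < lp) (hb : 0 < b) (hlm : 0 < lm)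
    (n : ℕ) (hx : x ≠ 0) :
    bilateralGammaJump (n + 1) a lp b lm x =
      lp * (bilateralGammaJump n (a - 1) lp b lm x - bilateralGammaJump n a lp b lm x) := by
  rw [bilateralGammaJump, iteratedDeriv_succ_bilateralGammaPDF_left ha hlp hb hlm n hx,
    iteratedDeriv_succ_bilateralGammaPDF_left ha hlp hb hlm n (neg_ne_zero.2 hx)]
  simp only [bilateralGammaJump]
  ring

theorem bilateralGammaJump_succ_right (ha : 0 < a) (hlp : 0 < lp) (hb : 1 < b) (hlm : 0 < lm)
    (n : ℕ) (hx : x ≠ 0) :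
    bilateralGammaJump (n + 1) a lp b lm x =
      lm * (bilateralGammaJump n a lp b lm x - bilateralGammaJump n a lp (b - 1) lm x) := by
  rw [bilateralGammaJump, iteratedDeriv_succ_bilateralGammaPDF_right ha hlp hb hlm n hx,
    iteratedDeriv_succ_bilateralGammaPDF_right ha hlp hb hlm n (neg_ne_zero.2 hx)]
  simp only [bilateralGammaJump]
  ring

theorem tendsto_bilateralGammaJump_succ_left (ha : 1 < a) (hlp : 0 < lp) (hb : 0 < b)
    (hlm : 0 < lm) {L L' : ℝ} (hL : Tendsto (bilateralGammaJump n (a - 1) lp b lm) (𝓝[>] 0) (𝓝 L))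
    (hL' : Tendsto (bilateralGammaJump n a lp b lm) (𝓝[>] 0) (𝓝 L')) :
    Tendsto (bilateralGammaJump (n + 1) a lp b lm) (𝓝[>] 0) (𝓝 (lp * (L - L'))) :=
  ((hL.sub hL').const_mul lp).congr' (eventually_mem_nhdsWithin.mono fun _ hx =>
    (bilateralGammaJump_succ_left ha hlp hb hlm n (Set.mem_Ioi.1 hx).ne').symm)

theorem tendsto_bilateralGammaJump_succ_right (ha : 0 < a) (hlp : 0 < lp) (hb : 1 < b)
    (hlm : 0 < lm) {L L' : ℝ} (hL : Tendsto (bilateralGammaJump n a lp b lm) (𝓝[>] 0) (𝓝 L))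
    (hL' : Tendsto (bilateralGammaJump n a lp (b - 1) lm) (𝓝[>] 0) (𝓝 L')) :
    Tendsto (bilateralGammaJump (n + 1) a lp b lm) (𝓝[>] 0) (𝓝 (lm * (L - L'))) :=
  ((hL.sub hL').const_mul lm).congr' (eventually_mem_nhdsWithin.mono fun _ hx =>
    (bilateralGammaJump_succ_right ha hlp hb hlm n (Set.mem_Ioi.1 hx).ne').symm)

theorem tendsto_bilateralGammaJump_nhds_zero (ha : 0 < a) (hlp : 0 < lp) (hb : 0 < b)
    (hlm : 0 < lm) (hn : n + 1 < a + b) :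
    Tendsto (bilateralGammaJump n a lp b lm) (𝓝[>] 0) (𝓝 0) := by
  induction n generalizing a b with
  | zero =>
    have hab : 1 < a + b := by simpa using hn
    have h := (tendsto_bilateralGammaPDF hlp hb hlm hab).sub
      (tendsto_bilateralGammaPDF hlm ha hlp (add_comm a b ▸ hab))
    rw [add_comm b a, add_comm lm lp, mul_comm (lm ^ b / _), sub_self] at h
    exact h.congr fun x => (bilateralGammaJump_zero a lp b lm x).symm
  | succ n ih =>
    push_cast at hn
    have hzero := ih ha hb (by linarith)
    rcases lt_or_ge 1 a with ha1 | ha1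
    · simpa using tendsto_bilateralGammaJump_succ_left ha1 hlp hb hlm
        (ih (sub_pos.2 ha1) hb (by linarith)) hzero
    · have hb1 : 1 < b := by linarith
      simpa using tendsto_bilateralGammaJump_succ_right ha hlp hb1 hlm hzero
        (ih ha (sub_pos.2 hb1) (by linarith))

theorem tendsto_exp_neg_mul_sub_exp_neg_mul_mul_log (r s : ℝ) :
    Tendsto (fun x => (Real.exp (-(r * x)) - Real.exp (-(s * x))) * -Real.log x) (𝓝[>] 0)
      (𝓝 0) := by
  have hexp (t : ℝ) : HasDerivAt (fun x => Real.exp (-(t * x))) (-t) 0 :=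
    ((hasDerivAt_id' (0 : ℝ)).const_mul t).fun_neg.exp.congr_deriv (by simp)
  have hslope := ((hexp r).fun_sub (hexp s)).tendsto_slope_zero_right
  have hlog := (tendsto_log_mul_rpow_nhdsGT_zero one_pos).neg
  refine (mul_zero (-r - -s) ▸ neg_zero (G := ℝ) ▸ hslope.mul hlog).congr' ?_
  filter_upwards [self_mem_nhdsWithin] with x (hx : 0 < x)
  have := hx.ne'
  simp only [zero_add, mul_zero, neg_zero, sub_self, sub_zero, smul_eq_mul, Real.rpow_one]
  field_simp

theorem tendsto_bilateralGammaJump_of_add_eq_one (ha : 0 < a) (hlp : 0 < lp) (hb : 0 < b)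
    (hlm : 0 < lm) (hab : a + b = 1) :
    Tendsto (bilateralGammaJump 0 a lp b lm) (𝓝[>] 0)
      (𝓝 (lp ^ a * lm ^ b * Real.cos (Real.pi * b))) := by
  have hs := add_pos hlp hlm
  have hswap := (tendsto_exp_neg_mul_nhdsGT_zero lp).mul
    (tendsto_shiftedGammaIntegral_sub_swap hs ha hb hab)
  have herr : Tendsto (fun x => (Real.exp (-(lp * x)) - Real.exp (-(lm * x))) *
      shiftedGammaIntegral (lp + lm) b a x) (𝓝[>] 0) (𝓝 0) := by
    have h := (tendsto_exp_neg_mul_sub_exp_neg_mul_mul_log lp lm).mul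
      (tendsto_shiftedGammaIntegral_div_neg_log hs ha (add_comm a b ▸ hab))
    refine (zero_mul (1 : ℝ) ▸ h).congr' ?_
    filter_upwards [Ioo_mem_nhdsGT one_pos] with x hx
    have hlog : Real.log x ≠ 0 := (Real.log_neg hx.1 hx.2).ne
    field_simp
  have hsin : Real.sin (Real.pi * b) ≠ 0 := (Real.sin_pos_of_pos_of_lt_pi (by positivity)
    (mul_lt_of_lt_one_right Real.pi_pos (by linarith))).ne'
  have hconst : lp ^ a * lm ^ b * Real.cos (Real.pi * b) =
      lp ^ a / Real.Gamma a * (lm ^ b / Real.Gamma b) *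
        (1 * (Real.pi * Real.cot (Real.pi * b)) + 0) := by
    rw [show Real.Gamma a = Real.Gamma (1 - b) by congr 1; linarith,
      div_Gamma_one_sub_mul_div_Gamma, Real.cot_eq_cos_div_sin]
    have := Real.pi_ne_zero
    field_simp
    ring
  rw [hconst]
  refine ((hswap.add herr).const_mul _).congr' ?_
  filter_upwards [self_mem_nhdsWithin] with x hx
  rw [bilateralGammaJump_zero, bilateralGammaPDF_eq a lp b lm hx, bilateralGammaPDF_eq b lm a lp hx,
    add_comm lm lp]
  ring

-- Lowering `b` flips the sign of the recursion, as does `cos (π (b - 1)) = - cos (π b)`.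
theorem tendsto_bilateralGammaJump (ha : 0 < a) (hlp : 0 < lp) (hb : 0 < b) (hlm : 0 < lm)
    (hab : a + b = n + 1) (hnat : ¬ ∃ m : ℕ, a = m) :
    Tendsto (bilateralGammaJump n a lp b lm) (𝓝[>] 0)
      (𝓝 (lp ^ a * lm ^ b * Real.cos (Real.pi * b))) := by
  induction n generalizing a b with
  | zero => exact tendsto_bilateralGammaJump_of_add_eq_one ha hlp hb hlm (by simpa using hab)
  | succ n ih =>
    push_cast at hab
    have hzero := tendsto_bilateralGammaJump_nhds_zero ha hlp hb hlm (by linarith : n + 1 < a + b)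
    have ha1 : a ≠ 1 := fun h => hnat ⟨1, by simpa using h⟩
    rcases ha1.lt_or_gt with ha1 | ha1
    · have hb1 : 1 < b := by linarith
      convert tendsto_bilateralGammaJump_succ_right ha hlp hb1 hlm hzero
        (ih ha (sub_pos.2 hb1) (by linarith) hnat) using 2
      rw [mul_sub_one, Real.cos_sub_pi, rpow_eq_mul_rpow_sub_one hlm b]
      ring
    · have hnat' : ¬ ∃ m : ℕ, a - 1 = m := fun ⟨m, hm⟩ => hnat ⟨m + 1, by push_cast; linarith⟩
      convert tendsto_bilateralGammaJump_succ_left ha1 hlp hb hlm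
        (ih (sub_pos.2 ha1) hb (by linarith) hnat') hzero using 2
      rw [rpow_eq_mul_rpow_sub_one hlp a]
      ring

end Jump

section Constants

variable {a lp b lm : ℝ}

theorem bilateralGammaOrder_lt (hab : 0 < a + b) : bilateralGammaOrder a b < a + b := by
  rw [bilateralGammaOrder, ← Nat.lt_ceil]
  exact Nat.sub_lt (Nat.ceil_pos.2 hab) one_pos

theorem add_eq_bilateralGammaOrder_add_one (hab : 0 < a + b) (hnat : ∃ n : ℕ, a + b = n) :
    a + b = bilateralGammaOrder a b + 1 := by
  obtain ⟨n, hn⟩ := hnat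
  have hn0 : 0 < n := Nat.cast_pos.1 (hn ▸ hab)
  rw [bilateralGammaOrder, hn, Nat.ceil_natCast, Nat.cast_pred hn0, sub_add_cancel]

theorem add_lt_bilateralGammaOrder_add_one (hnat : ¬ ∃ n : ℕ, a + b = n) :
    a + b < bilateralGammaOrder a b + 1 := by
  have hceil : ⌈a + b⌉₊ ≤ bilateralGammaOrder a b + 1 := le_tsub_add
  have hle : a + b ≤ (bilateralGammaOrder a b + 1 : ℕ) :=
    (Nat.le_ceil _).trans (Nat.cast_le.2 hceil)
  exact_mod_cast hle.lt_of_ne fun h => hnat ⟨_, h⟩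

theorem not_exists_eq_natCast_of_add (ha : 0 < a) (hnat : ¬ ∃ n : ℕ, a = n)
    (hab : ∃ n : ℕ, a + b = n) : ¬ ∃ n : ℕ, b = n := by
  rintro ⟨m, rfl⟩
  obtain ⟨n, hn⟩ := hab
  have hmn : m ≤ n := by
    have : (m : ℝ) ≤ n := by linarith
    exact_mod_cast this
  exact hnat ⟨n - m, by rw [Nat.cast_sub hmn]; linarith⟩

theorem neg_one_pow_floor_mul_sin_pos (ha : 0 < a) (hnat : ¬ ∃ n : ℕ, a = n) :
    0 < (-1) ^ ⌊a⌋₊ * Real.sin (Real.pi * a) := by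
  have hfloor : (⌊a⌋₊ : ℝ) < a := (Nat.floor_le ha.le).lt_of_ne fun h => hnat ⟨_, h.symm⟩
  have hfract : Real.pi * a - ⌊a⌋₊ * Real.pi = Real.pi * (a - ⌊a⌋₊) := by ring
  rw [← Real.sin_sub_nat_mul_pi, hfract]
  exact Real.sin_pos_of_pos_of_lt_pi (mul_pos Real.pi_pos (sub_pos.2 hfloor))
    (mul_lt_of_lt_one_right Real.pi_pos (by linarith [Nat.lt_floor_add_one a]))

theorem sin_pi_mul_ne_zero_of_not_natCast (ha : 0 < a) (hnat : ¬ ∃ n : ℕ, a = n) :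
    Real.sin (Real.pi * a) ≠ 0 :=
  right_ne_zero_of_mul (neg_one_pow_floor_mul_sin_pos ha hnat).ne'

theorem bilateralGammaC₁_ne_zero (ha : 0 < a) (hlp : 0 < lp) (hb : 0 < b) (hlm : 0 < lm)
    (hnat : ¬ ∃ n : ℕ, a = n) (hab : ¬ ∃ n : ℕ, a + b = n) : bilateralGammaC₁ a lp b lm ≠ 0 := by
  have hΓ : Real.Gamma (a + b - bilateralGammaOrder a b) ≠ 0 :=
    (Real.Gamma_pos_of_pos (sub_pos.2 (bilateralGammaOrder_lt (add_pos ha hb)))).ne'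
  have hrates : lp ^ a * lm ^ b ≠ 0 := by positivity
  rw [bilateralGammaC₁, mul_comm a, mul_comm (a + b)]
  exact div_ne_zero (mul_ne_zero hrates (sin_pi_mul_ne_zero_of_not_natCast ha hnat))
    (mul_ne_zero hΓ (sin_pi_mul_ne_zero_of_not_natCast (add_pos ha hb) hab))

theorem bilateralGammaC₁_eq (lp lm : ℝ) (hab : 0 < a + b) :
    bilateralGammaC₁ a lp b lm = lp ^ a * lm ^ b *
      (Real.Gamma (bilateralGammaOrder a b + 1 - a - b) *
        (Real.sin (Real.pi * (a - bilateralGammaOrder a b)) / Real.pi)) := by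
  have hlt := bilateralGammaOrder_lt hab
  rw [bilateralGammaC₁]
  generalize bilateralGammaOrder a b = N at hlt ⊢
  have hΓ : Real.Gamma (a + b - N) ≠ 0 := (Real.Gamma_pos_of_pos (sub_pos.2 hlt)).ne'
  have hsin (t : ℝ) : Real.sin (Real.pi * (t - N)) = (-1) ^ N * Real.sin (t * Real.pi) := by
    rw [← Real.sin_sub_nat_mul_pi]
    ring_nf
  have hreflect := Real.Gamma_mul_Gamma_one_sub (a + b - N)
  rw [show 1 - (a + b - N) = N + 1 - a - b by ring, hsin] at hreflect
  have hsign : (-1 : ℝ) ^ N ≠ 0 := by simp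
  have := Real.pi_ne_zero
  rw [hsin, eq_div_of_mul_eq hΓ ((mul_comm _ _).trans hreflect)]
  field_simp

theorem bilateralGammaC₂_eq (lp lm : ℝ) (hab : a + b = bilateralGammaOrder a b + 1) :
    bilateralGammaC₂ a lp b lm = lp ^ a * lm ^ b * Real.cos (Real.pi * b) := by
  rw [bilateralGammaC₂]
  generalize bilateralGammaOrder a b = N at hab ⊢
  have hangle : a * Real.pi = (N + 1 : ℕ) * Real.pi - Real.pi * b := by
    push_cast
    linear_combination Real.pi * hab
  have hsq : (-1 : ℝ) ^ (N + 1) * (-1) ^ (N + 1) = 1 := by rw [← mul_pow]; norm_num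
  rw [hangle, Real.cos_nat_mul_pi_sub, ← mul_assoc, hsq, mul_comm b]
  ring

end Constants

section SlowVariation

theorem tendsto_neg_log_nhdsNE_zero : Tendsto (fun x => -Real.log x) (𝓝[≠] 0) atTop :=
  tendsto_neg_atBot_atTop.comp Real.tendsto_log_nhdsNE_zero

theorem isSlowlyVaryingAtZero_const_mul_neg_log {k : ℝ} (hk : 0 < k) :
    IsSlowlyVaryingAtZero fun x => k * -Real.log x := by
  have hpos := tendsto_neg_log_nhdsNE_zero.eventually_gt_atTop 0
  refine ⟨by fun_prop, hpos.mono fun x => mul_pos hk, fun c hc => ?_⟩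
  have h := ((tendsto_const_nhds (x := -Real.log c)).div_atTop
    tendsto_neg_log_nhdsNE_zero).const_add 1
  refine (add_zero (1 : ℝ) ▸ h).congr' ?_
  filter_upwards [hpos, self_mem_nhdsWithin] with x hx hx0
  rw [Real.log_mul hc.ne' hx0, mul_div_mul_left _ _ hk.ne', neg_add_rev, add_div, div_self hx.ne']

theorem exists_isSlowlyVaryingAtZero_isEquivalent {f : ℝ → ℝ} {C : ℝ} {m : ℕ}
    (hC : 0 < (-1) ^ m * C) (h : Tendsto (fun x => f x / -Real.log x) (𝓝[≠] 0) (𝓝 C)) :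
    ∃ M : ℝ → ℝ, IsSlowlyVaryingAtZero M ∧ Tendsto M (𝓝[≠] 0) atTop ∧
      f ~[𝓝[≠] 0] fun x => (-1) ^ m * M x := by
  have hsq : (-1 : ℝ) ^ m * (-1) ^ m = 1 := by rw [← mul_pow]; norm_num
  refine ⟨_, isSlowlyVaryingAtZero_const_mul_neg_log hC,
    tendsto_neg_log_nhdsNE_zero.const_mul_atTop hC, ?_⟩
  simp only [← mul_assoc, hsq, one_mul]
  exact isEquivalent_const_mul_of_tendsto_div (right_ne_zero_of_mul hC.ne') h

end SlowVariation

section CriticalDerivative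

variable {a lp b lm : ℝ}

theorem tendsto_iteratedDeriv_bilateralGammaPDF_div_neg_log {n : ℕ} (ha : 0 < a) (hlp : 0 < lp)
    (hb : 0 < b) (hlm : 0 < lm) (hab : a + b = n + 1) :
    Tendsto (fun x => iteratedDeriv n (bilateralGammaPDF a lp b lm) x / -Real.log x)
      (𝓝[≠] 0) (𝓝 (lp ^ a * lm ^ b * (Real.sin (Real.pi * b) / Real.pi))) := by
  rw [← Set.Iio_union_Ioi, nhdsWithin_union, tendsto_sup]
  refine ⟨?_, tendsto_iteratedDeriv_bilateralGammaPDF_div_neg_log_nhdsGT hlp hb hlm hab⟩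
  have hangle : Real.pi * b = (n + 1 : ℕ) * Real.pi - Real.pi * a := by
    push_cast
    linear_combination Real.pi * hab
  have hsin : Real.sin (Real.pi * b) = (-1) ^ n * Real.sin (Real.pi * a) := by
    rw [hangle, Real.sin_nat_mul_pi_sub, pow_succ]
    ring
  have hneg : Tendsto (fun x : ℝ => -x) (𝓝[<] 0) (𝓝[>] 0) := by
    simpa using tendsto_neg_nhdsLT (a := (0 : ℝ))
  have hright := (tendsto_iteratedDeriv_bilateralGammaPDF_div_neg_log_nhdsGT hlm ha hlp
    (add_comm a b ▸ hab)).comp hneg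
  convert hright.const_mul ((-1) ^ n) using 2 with x
  · rw [bilateralGammaPDF_eq_comp_neg, iteratedDeriv_comp_neg, Function.comp_apply,
      Real.log_neg_eq_log, smul_eq_mul, mul_div_assoc]
  · rw [hsin]
    ring

theorem exists_isSlowlyVaryingAtZero_isEquivalent_iteratedDeriv_bilateralGammaPDF {n : ℕ}
    (ha : 0 < a) (hlp : 0 < lp) (hb : 0 < b) (hlm : 0 < lm) (hab : a + b = n + 1)
    (hnat : ¬ ∃ m : ℕ, b = m) :
    ∃ M : ℝ → ℝ, IsSlowlyVaryingAtZero M ∧ Tendsto M (𝓝[≠] 0) atTop ∧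
      iteratedDeriv n (bilateralGammaPDF a lp b lm) ~[𝓝[≠] 0] fun x => (-1) ^ ⌊b⌋₊ * M x := by
  refine exists_isSlowlyVaryingAtZero_isEquivalent ?_
    (tendsto_iteratedDeriv_bilateralGammaPDF_div_neg_log ha hlp hb hlm hab)
  have hsin := neg_one_pow_floor_mul_sin_pos hb hnat
  rw [mul_left_comm, ← mul_div_assoc]
  positivity

theorem tendsto_iteratedDeriv_bilateralGammaPDF_div_rpow_C₁ (ha : 0 < a) (hlp : 0 < lp)
    (hb : 0 < b) (hlm : 0 < lm) (hab : ¬ ∃ n : ℕ, a + b = n) :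
    Tendsto (fun x => iteratedDeriv (bilateralGammaOrder a b) (bilateralGammaPDF a lp b lm) x /
      x ^ (a + b - bilateralGammaOrder a b - 1)) (𝓝[>] 0) (𝓝 (bilateralGammaC₁ a lp b lm)) := by
  rw [bilateralGammaC₁_eq lp lm (add_pos ha hb)]
  exact tendsto_iteratedDeriv_bilateralGammaPDF_div_rpow hlp hb hlm
    (bilateralGammaOrder_lt (add_pos ha hb)) (add_lt_bilateralGammaOrder_add_one hab)

theorem isEquivalent_iteratedDeriv_bilateralGammaPDF (ha : 0 < a) (hlp : 0 < lp) (hb : 0 < b)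
    (hlm : 0 < lm) (hnat : ¬ ∃ n : ℕ, a = n) (hab : ¬ ∃ n : ℕ, a + b = n) :
    iteratedDeriv (bilateralGammaOrder a b) (bilateralGammaPDF a lp b lm) ~[𝓝[>] 0]
      fun x => bilateralGammaC₁ a lp b lm / x ^ (bilateralGammaOrder a b + 1 - a - b) := by
  refine (isEquivalent_const_mul_of_tendsto_div
    (bilateralGammaC₁_ne_zero ha hlp hb hlm hnat hab)
    (tendsto_iteratedDeriv_bilateralGammaPDF_div_rpow_C₁ ha hlp hb hlm hab)).congr_right ?_
  filter_upwards [self_mem_nhdsWithin] with x (hx : 0 < x)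
  rw [div_eq_mul_inv, ← Real.rpow_neg hx.le]
  ring_nf

theorem exists_tendsto_iteratedDeriv_bilateralGammaPDF_iff (ha : 0 < a) (hlp : 0 < lp)
    (hb : 0 < b) (hlm : 0 < lm) :
    (∃ l, Tendsto (iteratedDeriv (bilateralGammaOrder a b) (bilateralGammaPDF a lp b lm))
      (𝓝[>] 0) (𝓝 l)) ↔ ∃ n : ℕ, a = n := by
  have hlt := bilateralGammaOrder_lt (add_pos ha hb)
  refine ⟨fun ⟨l, hl⟩ => ?_, ?_⟩
  · by_contra hnat
    by_cases hab : ∃ n : ℕ, a + b = n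
    · have hsin := sin_pi_mul_ne_zero_of_not_natCast hb (not_exists_eq_natCast_of_add ha hnat hab)
      exact not_tendsto_nhds_of_tendsto_div (by positivity)
        (tendsto_neg_atBot_atTop.comp Real.tendsto_log_nhdsGT_zero)
        (tendsto_iteratedDeriv_bilateralGammaPDF_div_neg_log_nhdsGT hlp hb hlm
          (add_eq_bilateralGammaOrder_add_one (add_pos ha hb) hab)) l hl
    · exact not_tendsto_nhds_of_tendsto_div (bilateralGammaC₁_ne_zero ha hlp hb hlm hnat hab)
        (tendsto_rpow_neg_nhdsGT_zero (by linarith [add_lt_bilateralGammaOrder_add_one hab]))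
        (tendsto_iteratedDeriv_bilateralGammaPDF_div_rpow_C₁ ha hlp hb hlm hab) l hl
  · rintro ⟨m, rfl⟩
    exact exists_tendsto_iteratedDeriv_bilateralGammaPDF_natCast hlp hb hlm hlt

end CriticalDerivative

theorem theorem6p1 (αp lp αm lm : ℝ)
    (hαp : 0 < αp) (hlp : 0 < lp) (hαm : 0 < αm) (hlm : 0 < lm)
    (f : ℝ → ℝ) (hf : f = bilateralGammaPDF αp lp αm lm)
    (N : ℕ) (hN : N = bilateralGammaOrder αp αm) :
    -- the derivatives below are genuine ones
    ContDiffOn ℝ N f {0}ᶜ ∧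
    -- first part
    ((∃ l : ℝ, Tendsto (iteratedDeriv N f) (𝓝[>] 0) (𝓝 l)) ↔ ∃ n : ℕ, αp = n) ∧
    -- second part
    ((¬ ∃ n : ℕ, αp = n) → (¬ ∃ n : ℕ, αp + αm = n) →
      bilateralGammaC₁ αp lp αm lm ≠ 0 ∧
      (N + 1 - αp - αm) ∈ Set.Ioo (0 : ℝ) 1 ∧
      iteratedDeriv N f ~[𝓝[>] 0]
        fun x => bilateralGammaC₁ αp lp αm lm / x ^ (N + 1 - αp - αm)) ∧
    -- third part
    ((¬ ∃ n : ℕ, αp = n) → (∃ n : ℕ, αp + αm = n) →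
      (∃ M : ℝ → ℝ, IsSlowlyVaryingAtZero M ∧ Tendsto M (𝓝[≠] 0) atTop ∧
        iteratedDeriv N f ~[𝓝[≠] 0] fun x => (-1) ^ ⌊αm⌋₊ * M x) ∧
      Tendsto (fun x => iteratedDeriv N f x - iteratedDeriv N f (-x)) (𝓝[>] 0)
        (𝓝 (bilateralGammaC₂ αp lp αm lm))) := by
  subst hf hN
  have hpos := add_pos hαp hαm
  refine ⟨fun x hx => (contDiffAt_bilateralGammaPDF hαp hlp hαm hlm _ hx).contDiffWithinAt,
    exists_tendsto_iteratedDeriv_bilateralGammaPDF_iff hαp hlp hαm hlm,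
    fun hnat hab => ⟨bilateralGammaC₁_ne_zero hαp hlp hαm hlm hnat hab, ⟨?_, ?_⟩,
      isEquivalent_iteratedDeriv_bilateralGammaPDF hαp hlp hαm hlm hnat hab⟩,
    fun hnat hab => ?_⟩
  · linarith [add_lt_bilateralGammaOrder_add_one hab]
  · linarith [bilateralGammaOrder_lt hpos]
  · have horder := add_eq_bilateralGammaOrder_add_one hpos hab
    refine ⟨exists_isSlowlyVaryingAtZero_isEquivalent_iteratedDeriv_bilateralGammaPDF hαp hlp hαm
      hlm horder (not_exists_eq_natCast_of_add hαp hnat hab), ?_⟩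
    rw [bilateralGammaC₂_eq lp lm horder]
    exact tendsto_bilateralGammaJump hαp hlp hαm hlm horder hnat
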